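/- Let $a,b,q$ be complex numbers with $|q|<1$ and $|bq|<|a|<1/|b|$ (for $b=0$ the inequality $|a|<1/|b|$ is understood to impose no restriction). Write $(x;q)_\infty=\prod_{k\ge 0}(1-xq^k)$ and $(x,y;q)_\infty=(x;q)_\infty(y;q)_\infty$. Then the continued fraction $$c_0+\cfrac{c_1}{1+q^2+\cfrac{c_2}{1+q^4+\cfrac{c_3}{1+q^6+\cdots}}}$$ with $k$-th partial denominator $1+q^{2k}$ for $k\ge 1$, with $c_0=1+ab$ and, for $n\ge 0$, $$c_{2n+1}=-(a+bq^{2n+1})(b+aq^{2n+1})\,q^{2n},\qquad c_{2n+2}=(a-bq^{2n+1})(b-aq^{2n+1})\,q^{2n+2},$$ converges in $\hat{\mathbb C}=\mathbb C\cup\{\infty\}$, and its value is $$\frac{(a^2q,b^2q;q^4)_\infty}{(a^2q^3,b^2q^3;q^4)_\infty},$$ which is read as $\infty$ when the denominator is $0$. In other words, $$\frac{(a^2q,b^2q;q^4)_\infty}{(a^2q^3,b^2q^3;q^4)_\infty}=1+ab-\cfrac{(a+bq)(b+aq)}{1+q^2+\cfrac{(a-bq)(b-aq)q^2}{1+q^4-\cfrac{(a+bq^3)(b+aq^3)q^2}{1+q^6+\cfrac{(a-bq^3)(b-aq^3)q^4}{1+q^8-\cdots}}}}.$$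 Here convergence means that, for every sufficiently large $k$, the numerator $A_k$ and denominator $B_k$ of the $k$-th approximant, given by the usual three-term recurrence, are not both $0$, and that the points $A_k/B_k$ of $\hat{\mathbb C}$ tend to the stated value. -/

import Mathlib

open Filter Topology

/-- The infinite `q`-Pochhammer symbol `(x; q)_∞ = ∏_{k ≥ 0} (1 - x q ^ k)`. -/
noncomputable def qPochInf (x q : ℂ) : ℂ :=
  ∏' k : ℕ, (1 - x * q ^ k)

/-- The product defining `(x; q)_∞` converges for `|q| < 1`, so `qPochInf` is not a junk value. -/
theorem multipliable_qPochInf (x : ℂ) {q : ℂ} (hq : ‖q‖ < 1) :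
    Multipliable fun k : ℕ => 1 - x * q ^ k := by
  have h : Summable fun k : ℕ => ‖-(x * q ^ k)‖ := by
    simp only [norm_neg, norm_mul, norm_pow]
    exact (summable_geometric_of_lt_one (norm_nonneg q) hq).mul_left _
  simpa [sub_eq_add_neg] using multipliable_one_add_of_summable h

/-- The point `A / B` of the Riemann sphere `ℂ ∪ {∞}`, for `A`, `B` not both zero. -/
noncomputable def sphereQuot (A B : ℂ) : OnePoint ℂ :=
  open Classical in if B = 0 then OnePoint.infty else ((A / B : ℂ) : OnePoint ℂ)

/-- The continued fraction `g` converges to the point `f` of the Riemann sphere: its approximants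
`Aₙ / Bₙ` (with `Aₙ`, `Bₙ` the numerators and denominators given by the fundamental recurrence) are
well-defined points of the sphere for all large `n`, and they tend to `f`. -/
def CFConvergesTo (g : GenContFract ℂ) (f : OnePoint ℂ) : Prop :=
  (∀ᶠ n : ℕ in atTop, g.nums n ≠ 0 ∨ g.dens n ≠ 0) ∧
    Tendsto (fun n : ℕ => sphereQuot (g.nums n) (g.dens n)) atTop (𝓝 f)

/-- The partial numerators, indexed from `k = 0`: for `k = 2n` it is
`-(a + b q^(2n+1)) (b + a q^(2n+1)) q^(2n)`, and for `k = 2n + 1` it is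
`(a - b q^(2n+1)) (b - a q^(2n+1)) q^(2n+2)`. -/
noncomputable def cfPartNum (a b q : ℂ) (k : ℕ) : ℂ :=
  if Even k then -((a + b * q ^ (k + 1)) * (b + a * q ^ (k + 1)) * q ^ k)
  else (a - b * q ^ k) * (b - a * q ^ k) * q ^ (k + 1)

/-- The continued fraction
`1 + ab - (a+bq)(b+aq) / (1+q²) + (a-bq)(b-aq)q² / (1+q⁴) - (a+bq³)(b+aq³)q² / (1+q⁶) + ⋯`. -/
noncomputable def ramanujanCF (a b q : ℂ) : GenContFract ℂ where
  h := 1 + a * b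
  s := Stream'.Seq.ofStream fun k : ℕ => ⟨cfPartNum a b q k, 1 + q ^ (2 * (k + 1))⟩

/-! Numerators and denominators converge separately. If X solves the recurrence for (a, b), then
X_{k+1} + w_k X_k, with explicit w_k → 0, solves it for (aq, bq). Initial values show that this
turns denominators into numerators, and numerators into (1 - a²q)(1 - b²q) times denominators
(`cfRec_num_shift`, `cfRec_den_shift`). With N(a, b) the limit of the numerators, the denominators
thus tend to N(aq, bq), and N(a, b) = (1 - a²q)(1 - b²q) N(aq², bq²). Iterating towards (0, 0) gives
the infinite products times N(0, 0) ≠ 0, which cancels in the quotient. The bound |ab| < 1 keeps the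
two limits from vanishing together. -/

/-- The solution of the three-term recurrence of `ramanujanCF a b q` with initial values `x`, `y`. -/
noncomputable def cfRec (a b q x y : ℂ) : ℕ → ℂ
  | 0 => x
  | 1 => y
  | k + 2 => (1 + q ^ (2 * (k + 1))) * cfRec a b q x y (k + 1) +
      cfPartNum a b q k * cfRec a b q x y k

theorem ramanujanCF_contsAux (a b q : ℂ) (n : ℕ) :
    (ramanujanCF a b q).contsAux n =
        ⟨cfRec a b q 1 (1 + a * b) n, cfRec a b q 0 1 n⟩ ∧
      (ramanujanCF a b q).contsAux (n + 1) =
        ⟨cfRec a b q 1 (1 + a * b) (n + 1), cfRec a b q 0 1 (n + 1)⟩ := by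
  induction n with
  | zero => exact ⟨rfl, rfl⟩
  | succ n ih =>
    refine ⟨ih.2, ?_⟩
    have hs : (ramanujanCF a b q).s.get? n =
        some ⟨cfPartNum a b q n, 1 + q ^ (2 * (n + 1))⟩ := rfl
    rw [GenContFract.contsAux_recurrence hs ih.1 ih.2]
    rfl

theorem ramanujanCF_nums (a b q : ℂ) (n : ℕ) :
    (ramanujanCF a b q).nums n = cfRec a b q 1 (1 + a * b) (n + 1) := by
  rw [GenContFract.num_eq_conts_a, GenContFract.nth_cont_eq_succ_nth_contAux,
    (ramanujanCF_contsAux a b q n).2]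

theorem ramanujanCF_dens (a b q : ℂ) (n : ℕ) :
    (ramanujanCF a b q).dens n = cfRec a b q 0 1 (n + 1) := by
  rw [GenContFract.den_eq_conts_b, GenContFract.nth_cont_eq_succ_nth_contAux,
    (ramanujanCF_contsAux a b q n).2]

theorem eq_mul_cfRec {a b q x y t : ℂ} {Y : ℕ → ℂ} (h0 : Y 0 = t * x) (h1 : Y 1 = t * y)
    (h : ∀ k, Y (k + 2) = (1 + q ^ (2 * (k + 1))) * Y (k + 1) + cfPartNum a b q k * Y k) (k : ℕ) :
    Y k = t * cfRec a b q x y k := by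
  induction k using Nat.twoStepInduction with
  | zero => exact h0
  | one => exact h1
  | more k ih ih' => rw [h, ih, ih', cfRec]; ring

/-! ### Shifting (a, b) to (aq, bq) -/

/-- The weight in the relation between the continuants for `(a, b)` and for `(aq, bq)`. -/
noncomputable def shiftWeight (a b q : ℂ) (k : ℕ) : ℂ :=
  -q ^ (2 * k) + if Even k then -(a * b * q ^ k) else a * b * q ^ (k + 1)

theorem cfRec_shift_recurrence (a b q x y : ℂ) (k : ℕ) :
    cfRec a b q x y (k + 3) + shiftWeight a b q (k + 2) * cfRec a b q x y (k + 2) =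
      (1 + q ^ (2 * (k + 1))) *
        (cfRec a b q x y (k + 2) + shiftWeight a b q (k + 1) * cfRec a b q x y (k + 1)) +
      cfPartNum (a * q) (b * q) q k *
        (cfRec a b q x y (k + 1) + shiftWeight a b q k * cfRec a b q x y k) := by
  have h3 : cfRec a b q x y (k + 3) = (1 + q ^ (2 * (k + 2))) * cfRec a b q x y (k + 2) +
      cfPartNum a b q (k + 1) * cfRec a b q x y (k + 1) := rfl
  have h2 : cfRec a b q x y (k + 2) = (1 + q ^ (2 * (k + 1))) * cfRec a b q x y (k + 1) +
      cfPartNum a b q k * cfRec a b q x y k := rfl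
  rw [h3, h2]
  rcases Nat.even_or_odd' k with ⟨m, rfl | rfl⟩
  · simp only [cfPartNum, shiftWeight, Nat.even_add_one, even_two_mul, if_true, not_true, if_false,
      not_false_eq_true]
    ring
  · simp only [cfPartNum, shiftWeight, Nat.even_add_one, even_two_mul, if_true, not_true, if_false,
      not_false_eq_true]
    ring

theorem cfRec_num_shift (a b q : ℂ) (k : ℕ) :
    cfRec a b q 0 1 (k + 1) + shiftWeight a b q k * cfRec a b q 0 1 k =
      cfRec (a * q) (b * q) q 1 (1 + a * q * (b * q)) k := by
  rw [← one_mul (cfRec (a * q) (b * q) q 1 (1 + a * q * (b * q)) k)]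
  refine eq_mul_cfRec (Y := fun k => cfRec a b q 0 1 (k + 1) +
    shiftWeight a b q k * cfRec a b q 0 1 k) ?_ ?_ (cfRec_shift_recurrence a b q 0 1) k
  · simp [cfRec]
  · simp [cfRec, shiftWeight]
    ring

theorem cfRec_den_shift (a b q : ℂ) (k : ℕ) :
    cfRec a b q 1 (1 + a * b) (k + 1) + shiftWeight a b q k * cfRec a b q 1 (1 + a * b) k =
      (1 - a ^ 2 * q) * (1 - b ^ 2 * q) * cfRec (a * q) (b * q) q 0 1 k := by
  refine eq_mul_cfRec (Y := fun k => cfRec a b q 1 (1 + a * b) (k + 1) +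
    shiftWeight a b q k * cfRec a b q 1 (1 + a * b) k) ?_ ?_
    (cfRec_shift_recurrence a b q 1 (1 + a * b)) k
  · simp [cfRec, shiftWeight]
    ring
  · simp [cfRec, shiftWeight, cfPartNum]
    ring

/-! ### Bounds and convergence of the continuants -/

theorem norm_cfPartNum_le {a b q : ℂ} {R : ℝ} (hq : ‖q‖ < 1) (ha : ‖a‖ ≤ R) (hb : ‖b‖ ≤ R)
    (k : ℕ) : ‖cfPartNum a b q k‖ ≤ (2 * R) ^ 2 * ‖q‖ ^ k := by
  have hR : 0 ≤ R := (norm_nonneg a).trans ha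
  have hpow (j : ℕ) : ‖q ^ j‖ ≤ 1 := by
    rw [norm_pow]; exact pow_le_one₀ (norm_nonneg q) hq.le
  have hmul {z : ℂ} (hz : ‖z‖ ≤ R) (j : ℕ) : ‖z * q ^ j‖ ≤ R := by
    rw [norm_mul]
    exact (mul_le_of_le_one_right (norm_nonneg z) (hpow j)).trans hz
  have hadd {z w : ℂ} (hz : ‖z‖ ≤ R) (hw : ‖w‖ ≤ R) : ‖z + w‖ ≤ 2 * R :=
    (norm_add_le z w).trans (by linarith)
  have hsub {z w : ℂ} (hz : ‖z‖ ≤ R) (hw : ‖w‖ ≤ R) : ‖z - w‖ ≤ 2 * R :=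
    (norm_sub_le z w).trans (by linarith)
  unfold cfPartNum
  split_ifs
  · rw [norm_neg, norm_mul, norm_mul, norm_pow, sq]
    gcongr
    · exact hadd ha (hmul hb _)
    · exact hadd hb (hmul ha _)
  · rw [norm_mul, norm_mul, norm_pow, sq]
    gcongr ?_ * ?_ * ?_
    · exact hsub ha (hmul hb _)
    · exact hsub hb (hmul ha _)
    · exact pow_le_pow_of_le_one (norm_nonneg q) hq.le k.le_succ

theorem norm_cfRec_sub_le {a b q x y : ℂ} {R M : ℝ} (hq : ‖q‖ < 1) (ha : ‖a‖ ≤ R) (hb : ‖b‖ ≤ R)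
    (k : ℕ) (h0 : ‖cfRec a b q x y k‖ ≤ M) (h1 : ‖cfRec a b q x y (k + 1)‖ ≤ M) :
    ‖cfRec a b q x y (k + 2) - cfRec a b q x y (k + 1)‖ ≤ M * ((1 + (2 * R) ^ 2) * ‖q‖ ^ k) := by
  have hM : 0 ≤ M := (norm_nonneg _).trans h0
  have h : cfRec a b q x y (k + 2) - cfRec a b q x y (k + 1) =
      q ^ (2 * (k + 1)) * cfRec a b q x y (k + 1) + cfPartNum a b q k * cfRec a b q x y k := by
    rw [cfRec]; ring
  calc
    _ ≤ ‖q‖ ^ k * M + (2 * R) ^ 2 * ‖q‖ ^ k * M := by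
      rw [h]
      refine (norm_add_le _ _).trans ?_
      rw [norm_mul, norm_mul, norm_pow]
      gcongr ?_ * ?_ + ?_ * ?_
      · exact pow_le_pow_of_le_one (norm_nonneg q) hq.le (by lia)
      · exact norm_cfPartNum_le hq ha hb k
    _ = _ := by ring

theorem norm_cfRec_le {a b q x y : ℂ} {R M : ℝ} (hq : ‖q‖ < 1) (ha : ‖a‖ ≤ R) (hb : ‖b‖ ≤ R)
    (hx : ‖x‖ ≤ M) (hy : ‖y‖ ≤ M) (k : ℕ) :
    ‖cfRec a b q x y k‖ ≤ M * Real.exp ((1 + (2 * R) ^ 2) * (1 - ‖q‖)⁻¹) := by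
  have hM : 0 ≤ M := (norm_nonneg x).trans hx
  -- Discrete Grönwall: two consecutive terms share one bound, as the recurrence has order two.
  have key : ∀ k, ‖cfRec a b q x y k‖ ≤
        M * ∏ i ∈ Finset.range k, (1 + (1 + (2 * R) ^ 2) * ‖q‖ ^ i) ∧
      ‖cfRec a b q x y (k + 1)‖ ≤
        M * ∏ i ∈ Finset.range k, (1 + (1 + (2 * R) ^ 2) * ‖q‖ ^ i) := by
    intro k
    induction k with
    | zero => simpa [cfRec] using ⟨hx, hy⟩
    | succ k ih =>
      rw [Finset.prod_range_succ]
      set P := ∏ i ∈ Finset.range k, (1 + (1 + (2 * R) ^ 2) * ‖q‖ ^ i)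
      have hMP : 0 ≤ M * P := (norm_nonneg _).trans ih.1
      have hε : 0 ≤ (1 + (2 * R) ^ 2) * ‖q‖ ^ k := by positivity
      constructor
      · nlinarith [ih.2, mul_nonneg hMP hε]
      · have h1 := norm_cfRec_sub_le hq ha hb k ih.1 ih.2
        have h2 := norm_le_norm_add_norm_sub' (cfRec a b q x y (k + 2)) (cfRec a b q x y (k + 1))
        show ‖cfRec a b q x y (k + 2)‖ ≤ _
        linarith [ih.2]
  refine (key k).1.trans (mul_le_mul_of_nonneg_left ?_ hM)
  refine (Real.prod_one_add_le_exp_sum _ fun i => by positivity).trans (Real.exp_le_exp.2 ?_)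
  rw [← Finset.mul_sum, ← tsum_geometric_of_lt_one (norm_nonneg q) hq]
  gcongr
  exact (summable_geometric_of_lt_one (norm_nonneg q) hq).sum_le_tsum _ fun i _ => by positivity

/-- Uniformity in a and b is what permits dominated convergence as (a, b) → (0, 0). -/
theorem exists_summable_bound_cfRec_sub {q : ℂ} (hq : ‖q‖ < 1) (R M : ℝ) :
    ∃ u : ℕ → ℝ, Summable u ∧ ∀ a b x y : ℂ, ‖a‖ ≤ R → ‖b‖ ≤ R → ‖x‖ ≤ M → ‖y‖ ≤ M →
      ∀ k, ‖cfRec a b q x y (k + 2) - cfRec a b q x y (k + 1)‖ ≤ u k :=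
  ⟨_, ((summable_geometric_of_lt_one (norm_nonneg q) hq).mul_left _).mul_left _,
    fun _ _ _ _ ha hb hx hy k => norm_cfRec_sub_le hq ha hb k
      (norm_cfRec_le hq ha hb hx hy k) (norm_cfRec_le hq ha hb hx hy (k + 1))⟩

theorem tendsto_cfRec {q : ℂ} (hq : ‖q‖ < 1) (a b x y : ℂ) :
    Tendsto (cfRec a b q x y) atTop
      (𝓝 (y + ∑' k, (cfRec a b q x y (k + 2) - cfRec a b q x y (k + 1)))) := by
  obtain ⟨u, hu, h⟩ := exists_summable_bound_cfRec_sub hq (max ‖a‖ ‖b‖) (max ‖x‖ ‖y‖)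
  have hs : Summable fun k => cfRec a b q x y (k + 2) - cfRec a b q x y (k + 1) :=
    hu.of_norm_bounded (h a b x y (le_max_left ..) (le_max_right ..) (le_max_left ..)
      (le_max_right ..))
  rw [← tendsto_add_atTop_iff_nat 1]
  refine (hs.hasSum.tendsto_sum_nat.const_add y).congr fun n => ?_
  rw [Finset.sum_range_sub (fun k => cfRec a b q x y (k + 1)) n]
  simp [cfRec]

/-! ### Functional equation and product formula for the limits -/

/-- The limit of the numerators of `ramanujanCF a b q`. -/
noncomputable def cfNumLim (a b q : ℂ) : ℂ :=
  1 + a * b + ∑' k, (cfRec a b q 1 (1 + a * b) (k + 2) - cfRec a b q 1 (1 + a * b) (k + 1))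

theorem tendsto_cfNumLim {q : ℂ} (hq : ‖q‖ < 1) (a b : ℂ) :
    Tendsto (cfRec a b q 1 (1 + a * b)) atTop (𝓝 (cfNumLim a b q)) :=
  tendsto_cfRec hq a b 1 (1 + a * b)

theorem tendsto_shiftWeight {q : ℂ} (hq : ‖q‖ < 1) (a b : ℂ) :
    Tendsto (shiftWeight a b q) atTop (𝓝 0) := by
  have h := tendsto_pow_atTop_nhds_zero_of_norm_lt_one hq
  have h2 : Tendsto (fun k => q ^ (2 * k)) atTop (𝓝 0) :=
    h.comp (tendsto_id.const_mul_atTop' two_pos)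
  have h3 : Tendsto (fun k => if Even k then -(a * b * q ^ k) else a * b * q ^ (k + 1))
      atTop (𝓝 0) := by
    refine Tendsto.if' ?_ ?_
    · simpa using (h.const_mul (a * b)).neg
    · simpa using ((tendsto_add_atTop_iff_nat 1).2 h).const_mul (a * b)
  have h := h2.neg.add h3
  rwa [neg_zero, add_zero] at h

theorem tendsto_cfRec_den {q : ℂ} (hq : ‖q‖ < 1) (a b : ℂ) :
    Tendsto (cfRec a b q 0 1) atTop (𝓝 (cfNumLim (a * q) (b * q) q)) := by
  have hB := tendsto_cfRec hq a b 0 1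
  have h := ((tendsto_add_atTop_iff_nat 1).2 hB).add ((tendsto_shiftWeight hq a b).mul hB)
  simp only [cfRec_num_shift] at h
  rw [tendsto_nhds_unique (tendsto_cfNumLim hq (a * q) (b * q)) h, zero_mul, add_zero]
  exact hB

theorem cfNumLim_eq_mul_shift {q : ℂ} (hq : ‖q‖ < 1) (a b : ℂ) :
    cfNumLim a b q =
      (1 - a ^ 2 * q) * (1 - b ^ 2 * q) * cfNumLim (a * q ^ 2) (b * q ^ 2) q := by
  have hA := tendsto_cfNumLim hq a b
  have h := ((tendsto_add_atTop_iff_nat 1).2 hA).add ((tendsto_shiftWeight hq a b).mul hA)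
  simp only [cfRec_den_shift] at h
  have h' := (tendsto_cfRec_den hq (a * q) (b * q)).const_mul ((1 - a ^ 2 * q) * (1 - b ^ 2 * q))
  simpa [mul_assoc, ← sq] using tendsto_nhds_unique h h'

theorem cfNumLim_eq_prod_mul {q : ℂ} (hq : ‖q‖ < 1) (a b : ℂ) (N : ℕ) :
    cfNumLim a b q = (∏ k ∈ Finset.range N, (1 - a ^ 2 * q * (q ^ 4) ^ k)) *
      (∏ k ∈ Finset.range N, (1 - b ^ 2 * q * (q ^ 4) ^ k)) *
      cfNumLim (a * q ^ (2 * N)) (b * q ^ (2 * N)) q := by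
  induction N with
  | zero => simp
  | succ N ih =>
    rw [ih, cfNumLim_eq_mul_shift hq, Finset.prod_range_succ, Finset.prod_range_succ]
    ring_nf

theorem continuous_cfRec (q : ℂ) (k : ℕ) :
    Continuous fun p : ℂ × ℂ => cfRec p.1 p.2 q 1 (1 + p.1 * p.2) k := by
  induction k using Nat.twoStepInduction with
  | zero => simpa [cfRec] using continuous_const
  | one => simp only [cfRec]; fun_prop
  | more k ih ih' =>
    simp only [cfRec, cfPartNum]
    split_ifs <;> fun_prop

theorem tendsto_cfNumLim_zero {q : ℂ} (hq : ‖q‖ < 1) (a b : ℂ) :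
    Tendsto (fun N : ℕ => cfNumLim (a * q ^ (2 * N)) (b * q ^ (2 * N)) q) atTop
      (𝓝 (cfNumLim 0 0 q)) := by
  have hpow : Tendsto (fun N : ℕ => q ^ (2 * N)) atTop (𝓝 0) :=
    (tendsto_pow_atTop_nhds_zero_of_norm_lt_one hq).comp (tendsto_id.const_mul_atTop' two_pos)
  have hab : Tendsto (fun N : ℕ => (a * q ^ (2 * N), b * q ^ (2 * N))) atTop (𝓝 (0, 0)) := by
    simpa using (hpow.const_mul a).prodMk_nhds (hpow.const_mul b)
  have hX (k : ℕ) := ((continuous_cfRec q k).tendsto (0, 0)).comp hab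
  set R := max ‖a‖ ‖b‖
  obtain ⟨u, hu, h⟩ := exists_summable_bound_cfRec_sub hq R (1 + R * R)
  have hle {z : ℂ} (hz : ‖z‖ ≤ R) (N : ℕ) : ‖z * q ^ (2 * N)‖ ≤ R := by
    rw [norm_mul, norm_pow]
    exact (mul_le_of_le_one_right (norm_nonneg z)
      (pow_le_one₀ (norm_nonneg q) hq.le)).trans hz
  have hR : 0 ≤ R := (norm_nonneg a).trans (le_max_left ..)
  -- The term of index 1 is 1 + ab, the part of the limit outside the series.
  refine Tendsto.add (hX 1) ?_
  refine tendsto_tsum_of_dominated_convergence hu (fun k => (hX (k + 2)).sub (hX (k + 1))) ?_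
  refine Eventually.of_forall fun N k => h _ _ _ _ (hle (le_max_left ..) N) (hle (le_max_right ..) N)
    ?_ ?_ k
  · rw [norm_one]; nlinarith
  · refine (norm_add_le _ _).trans ?_
    rw [norm_one, norm_mul]
    gcongr
    · exact hle (le_max_left ..) N
    · exact hle (le_max_right ..) N

theorem norm_pow_four_lt_one {q : ℂ} (hq : ‖q‖ < 1) : ‖q ^ 4‖ < 1 := by
  rw [norm_pow]; exact pow_lt_one₀ (norm_nonneg q) hq (by norm_num)

theorem cfNumLim_eq_qPochInf {q : ℂ} (hq : ‖q‖ < 1) (a b : ℂ) :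
    cfNumLim a b q =
      qPochInf (a ^ 2 * q) (q ^ 4) * qPochInf (b ^ 2 * q) (q ^ 4) * cfNumLim 0 0 q := by
  have h (x : ℂ) := (multipliable_qPochInf x (norm_pow_four_lt_one hq)).hasProd.tendsto_prod_nat
  refine tendsto_nhds_unique ?_
    (((h (a ^ 2 * q)).mul (h (b ^ 2 * q))).mul (tendsto_cfNumLim_zero hq a b))
  simp only [← cfNumLim_eq_prod_mul hq]
  exact tendsto_const_nhds

/-! ### Non-vanishing -/

theorem cfRec_zero_zero (q : ℂ) (k : ℕ) :
    cfRec 0 0 q 1 (1 + 0 * 0) (k + 1) = ∏ i ∈ Finset.range k, (1 + q ^ (2 * (i + 1))) := by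
  induction k with
  | zero => simp [cfRec]
  | succ k ih => rw [cfRec, ih, Finset.prod_range_succ]; simp [cfPartNum]; ring

theorem cfNumLim_zero_zero_ne_zero {q : ℂ} (hq : ‖q‖ < 1) : cfNumLim 0 0 q ≠ 0 := by
  have hlt (i : ℕ) : ‖q ^ (2 * (i + 1))‖ < 1 := by
    rw [norm_pow]; exact pow_lt_one₀ (norm_nonneg q) hq (by lia)
  have hs : Summable fun i : ℕ => ‖q ^ (2 * (i + 1))‖ := by
    simp only [norm_pow]
    exact (summable_geometric_of_lt_one (norm_nonneg q) hq).comp_injective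
      (i := fun i : ℕ => 2 * (i + 1)) fun i j h => by simpa using h
  have h := (multipliable_one_add_of_summable hs).hasProd.tendsto_prod_nat
  simp only [← cfRec_zero_zero] at h
  rw [tendsto_nhds_unique ((tendsto_add_atTop_iff_nat 1).2 (tendsto_cfNumLim hq 0 0)) h]
  refine tprod_one_add_ne_zero_of_summable (fun i hi => ?_) hs
  have := hlt i
  rw [eq_neg_of_add_eq_zero_right hi] at this
  simp at this

theorem exists_mul_pow_eq_one_of_qPochInf_eq_zero {x q : ℂ} (hq : ‖q‖ < 1)
    (h : qPochInf x q = 0) : ∃ k : ℕ, x * q ^ k = 1 := by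
  by_contra! hne
  have hs : Summable fun k : ℕ => ‖-(x * q ^ k)‖ := by
    simp only [norm_neg, norm_mul, norm_pow]
    exact (summable_geometric_of_lt_one (norm_nonneg q) hq).mul_left _
  refine tprod_one_add_ne_zero_of_summable (fun k hk => hne k ?_) hs ?_
  · linear_combination -hk
  · simpa [qPochInf, sub_eq_add_neg] using h

/-- Common vanishing would equate powers of q with exponents 1 and 3 mod 4, while 0 < |q| < 1. -/
theorem qPochInf_ne_zero_or_ne_zero {a q : ℂ} (hq : ‖q‖ < 1) :
    qPochInf (a ^ 2 * q) (q ^ 4) ≠ 0 ∨ qPochInf (a ^ 2 * q ^ 3) (q ^ 4) ≠ 0 := by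
  by_contra! h
  obtain ⟨k, hk⟩ := exists_mul_pow_eq_one_of_qPochInf_eq_zero (norm_pow_four_lt_one hq) h.1
  obtain ⟨m, hm⟩ := exists_mul_pow_eq_one_of_qPochInf_eq_zero (norm_pow_four_lt_one hq) h.2
  have ha : a ≠ 0 := by rintro rfl; simp at hk
  have hq0 : q ≠ 0 := by rintro rfl; simp at hk
  have he : q ^ (4 * k + 1) = q ^ (4 * m + 3) := by
    refine mul_left_cancel₀ (pow_ne_zero 2 ha) ?_
    linear_combination hk - hm
  have hn : ‖q‖ ^ (4 * k + 1) = ‖q‖ ^ (4 * m + 3) := by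
    rw [← norm_pow, he, norm_pow]
  have := pow_right_injective₀ (norm_pos_iff.2 hq0) hq.ne hn
  lia

theorem qPochInf_ne_zero_or_ne_zero_of_mul {a b q : ℂ} (hq : ‖q‖ < 1) (hab : ‖a * b‖ < 1) :
    qPochInf (a ^ 2 * q) (q ^ 4) ≠ 0 ∨ qPochInf (b ^ 2 * q ^ 3) (q ^ 4) ≠ 0 := by
  by_contra! h
  obtain ⟨k, hk⟩ := exists_mul_pow_eq_one_of_qPochInf_eq_zero (norm_pow_four_lt_one hq) h.1
  obtain ⟨m, hm⟩ := exists_mul_pow_eq_one_of_qPochInf_eq_zero (norm_pow_four_lt_one hq) h.2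
  have he : (a * b) ^ 2 * q ^ (4 * (k + m + 1)) = 1 := by
    calc
      _ = (a ^ 2 * q * (q ^ 4) ^ k) * (b ^ 2 * q ^ 3 * (q ^ 4) ^ m) := by ring
      _ = 1 := by rw [hk, hm, one_mul]
  have hlt : ‖(a * b) ^ 2 * q ^ (4 * (k + m + 1))‖ < 1 := by
    rw [norm_mul, norm_pow, norm_pow]
    exact mul_lt_one_of_nonneg_of_lt_one_left (by positivity)
      (pow_lt_one₀ (norm_nonneg _) hab two_ne_zero) (pow_le_one₀ (norm_nonneg q) hq.le)
  rw [he] at hlt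
  simp at hlt

/-! ### Convergence on the sphere -/

theorem sphereQuot_mul_right (A B : ℂ) {t : ℂ} (ht : t ≠ 0) :
    sphereQuot (A * t) (B * t) = sphereQuot A B := by
  simp [sphereQuot, ht, mul_div_mul_right]

/-- The quotient map to the Riemann sphere is continuous away from `(0, 0)`. -/
theorem tendsto_sphereQuot {ι : Type*} {l : Filter ι} {f g : ι → ℂ} {A B : ℂ}
    (hf : Tendsto f l (𝓝 A)) (hg : Tendsto g l (𝓝 B)) (hAB : A ≠ 0 ∨ B ≠ 0) :
    Tendsto (fun i => sphereQuot (f i) (g i)) l (𝓝 (sphereQuot A B)) := by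
  by_cases hB : B = 0
  · have hA : A ≠ 0 := hAB.resolve_right (not_not.2 hB)
    subst hB
    rw [sphereQuot, if_pos rfl]
    intro s hs
    have hs' : ((↑) : ℂ → OnePoint ℂ) ⁻¹' s ∈ cocompact ℂ := by
      rw [← coclosedCompact_eq_cocompact]
      exact OnePoint.tendsto_coe_infty hs
    obtain ⟨r, hr⟩ := (Metric.mem_cocompact_iff_closedBall_compl_subset 0).1 hs'
    -- Here g → 0 and f → A ≠ 0, so the quotient leaves every disc.
    have hlt : ∀ᶠ i in l, r * ‖g i‖ < ‖f i‖ :=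
      (hg.norm.const_mul r).eventually_lt hf.norm (by simpa using hA)
    rw [mem_map]
    filter_upwards [hlt] with i hi
    show sphereQuot (f i) (g i) ∈ s
    unfold sphereQuot
    split_ifs with h
    · exact mem_of_mem_nhds hs
    · refine hr ?_
      simpa [lt_div_iff₀ (norm_pos_iff.2 h)] using hi
  · rw [sphereQuot, if_neg hB]
    refine ((OnePoint.continuous_coe.tendsto _).comp (hf.div hg hB)).congr' ?_
    filter_upwards [hg.eventually_ne hB] with i hi
    simp [sphereQuot, hi]

theorem mainTheorem6 (a b q : ℂ) (hq : ‖q‖ < 1) (hbq : ‖b * q‖ < ‖a‖)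
    (hab : b = 0 ∨ ‖a‖ < 1 / ‖b‖) :
    CFConvergesTo (ramanujanCF a b q)
      (sphereQuot (qPochInf (a ^ 2 * q) (q ^ 4) * qPochInf (b ^ 2 * q) (q ^ 4))
        (qPochInf (a ^ 2 * q ^ 3) (q ^ 4) * qPochInf (b ^ 2 * q ^ 3) (q ^ 4))) := by
  have hab1 : ‖a * b‖ < 1 := by
    rcases eq_or_ne b 0 with rfl | hb
    · simp
    · rw [norm_mul, ← lt_div_iff₀ (norm_pos_iff.2 hb)]
      exact hab.resolve_left hb
  have hba1 : ‖b * a‖ < 1 := by rwa [mul_comm]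
  have hK := cfNumLim_zero_zero_ne_zero hq
  have hA := (tendsto_add_atTop_iff_nat 1).2 (tendsto_cfNumLim hq a b)
  have hB := (tendsto_add_atTop_iff_nat 1).2 (tendsto_cfRec_den hq a b)
  simp only [← ramanujanCF_nums, ← ramanujanCF_dens] at hA hB
  rw [cfNumLim_eq_qPochInf hq] at hA hB
  have e (z : ℂ) : (z * q) ^ 2 * q = z ^ 2 * q ^ 3 := by ring
  rw [e, e] at hB
  have hne : qPochInf (a ^ 2 * q) (q ^ 4) * qPochInf (b ^ 2 * q) (q ^ 4) * cfNumLim 0 0 q ≠ 0 ∨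
      qPochInf (a ^ 2 * q ^ 3) (q ^ 4) * qPochInf (b ^ 2 * q ^ 3) (q ^ 4) * cfNumLim 0 0 q ≠ 0 := by
    -- Each numerator factor is paired with each denominator factor.
    have h1 := qPochInf_ne_zero_or_ne_zero (a := a) hq
    have h2 := qPochInf_ne_zero_or_ne_zero (a := b) hq
    have h3 := qPochInf_ne_zero_or_ne_zero_of_mul hq hab1
    have h4 := qPochInf_ne_zero_or_ne_zero_of_mul hq hba1
    simp only [mul_ne_zero_iff]
    tauto
  constructor
  · rcases hne with h | h
    · exact (hA.eventually_ne h).mono fun _ => Or.inl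
    · exact (hB.eventually_ne h).mono fun _ => Or.inr
  · simpa only [sphereQuot_mul_right _ _ hK] using tendsto_sphereQuot hA hB hne
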